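/- Let $\sigma,L,T>0$. Consider on $[0,T]\times\mathbf R^3$ the three-dimensional incompressible Navier--Stokes equations with negative direction of time $$\frac{\partial u}{\partial t}+\frac{\sigma^2}{2}\Delta u-(u,\nabla)u-\nabla p+f=0\quad(0\le t<T),\qquad \operatorname{div}u=0,\qquad u(T,x)=\varphi(x),$$ where $u$, $p$ and $f$ are $L$-periodic in each space direction and $\int_{(0,L]^3}u(t,x)\,dx=0$. Assume that $(u,p)$ is a smooth classical solution: $u$ is three times continuously differentiable on $[0,T]\times\mathbf R^3$ and, for each $t\in[0,T)$, $p(t,\cdot)$ is $C^2$ and $f(t,\cdot)$ is $C^1$. Put $\omega=\operatorname{curl}u$ and $g=\operatorname{curl}f$. For an integer $N\ge1$ let $h=T/N$ and $t_k=kh$, $k=0,\dots,N$. For $0\le k\le N-1$ freeze the velocity on $[t_k,t_{k+1})$ at $\hat u(x):=u(t_{k+1},x)$, and let $\tilde\omega$ be a classical solution, $L$-periodic in each space direction, of the linear system $$\frac{\partial\tilde\omega^i}{\partial t}+\frac{\sigma^2}{2}\Delta\tilde\omega^i-\sum_{j=1}^3\hat u^j\frac{\partial\tilde\omega^i}{\partial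 x^j}+\sum_{j=1}^3\frac{\partial\hat u^i}{\partial x^j}\tilde\omega^j+g^i=0,\quad t_k\le t<t_{k+1},\quad i=1,2,3,$$ $$\tilde\omega(t_{k+1},x)=\omega(t_{k+1},x),$$ that is, $\tilde\omega$ is continuous on $[t_k,t_{k+1}]\times\mathbf R^3$ and, for $t_k\le t<t_{k+1}$, differentiable in $t$ (one-sidedly at $t_k$) and twice continuously differentiable in $x$. Then the one-step error $\delta_\omega:=\omega-\tilde\omega$ is of second order with respect to $h$: there is a constant $K>0$, depending only on $\sigma,L,T,f,\varphi,u,p$ (and not on $N$, $k$, $\tilde\omega$, $t$ or $x$), such that for all $N\ge1$ and $0\le k\le N-1$ and every such $\tilde\omega$, $$|\delta_\omega(t,x)|\le Kh^2,\qquad t_k\le t\le t_{k+1},\ x\in\mathbf R^3.$$ -/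

import Mathlib

open Set

noncomputable section

/-- Euclidean three-dimensional space. -/
abbrev R3 := EuclideanSpace ℝ (Fin 3)

/-- The `j`-th vector of the canonical basis of `ℝ³`. -/
def basisVec (j : Fin 3) : R3 := EuclideanSpace.single j 1

/-- The partial derivative `∂φ/∂xʲ (x)` of a scalar function. -/
def pderivR3 (j : Fin 3) (φ : R3 → ℝ) (x : R3) : ℝ := fderiv ℝ φ x (basisVec j)

/-- The divergence of a vector field. -/
def divR3 (v : R3 → R3) (x : R3) : ℝ := ∑ j, pderivR3 j (fun y => v y j) x

/-- The curl of a vector field. -/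
def curlR3 (v : R3 → R3) (x : R3) : R3 :=
  !₂[pderivR3 1 (fun y => v y 2) x - pderivR3 2 (fun y => v y 1) x,
     pderivR3 2 (fun y => v y 0) x - pderivR3 0 (fun y => v y 2) x,
     pderivR3 0 (fun y => v y 1) x - pderivR3 1 (fun y => v y 0) x]

/-- The `i`-th component of `(a, ∇) v` at `x`, that is `∑ⱼ aʲ(x) ∂vⁱ/∂xʲ(x)`. -/
def advectR3 (a v : R3 → R3) (i : Fin 3) (x : R3) : ℝ :=
  ∑ j, a x j * pderivR3 j (fun y => v y i) x

/-- Periodicity with period `L` in each of the three coordinate directions. -/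
def IsPeriodicR3 {F : Type*} (L : ℝ) (v : R3 → F) : Prop :=
  ∀ (j : Fin 3) (x : R3), v (x + L • basisVec j) = v x

/-- `(u, p)` is a smooth space-periodic classical solution, with zero space average, of the
incompressible Navier-Stokes equations with negative direction of time on `[0, T]`, with forcing
`f` and terminal velocity `φ`. Derivatives in time at an end point of `[0, T]` are one-sided. -/
structure IsNSESolution (σ L T : ℝ) (f : ℝ → R3 → R3) (φ : R3 → R3)
    (u : ℝ → R3 → R3) (p : ℝ → R3 → ℝ) : Prop where
  smooth_u : ContDiffOn ℝ 3 (Function.uncurry u) (Icc 0 T ×ˢ univ)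
  smooth_p : ∀ t ∈ Ico 0 T, ContDiff ℝ 2 (p t)
  smooth_f : ∀ t ∈ Ico 0 T, ContDiff ℝ 1 (f t)
  periodic_u : ∀ t ∈ Icc 0 T, IsPeriodicR3 L (u t)
  periodic_p : ∀ t ∈ Ico 0 T, IsPeriodicR3 L (p t)
  periodic_f : ∀ t ∈ Ico 0 T, IsPeriodicR3 L (f t)
  average_u : ∀ t ∈ Icc 0 T, ∫ x in {x : R3 | ∀ j, x j ∈ Ioc 0 L}, u t x = 0
  div_u : ∀ t ∈ Icc 0 T, ∀ x, divR3 (u t) x = 0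
  momentum : ∀ t ∈ Ico 0 T, ∀ x, ∀ i : Fin 3,
    derivWithin (fun s => u s x i) (Icc 0 T) t
      + σ ^ 2 / 2 * Laplacian.laplacian (fun y => u t y i) x
      - advectR3 (u t) (u t) i x - pderivR3 i (p t) x + f t x i = 0
  terminal : ∀ x, u T x = φ x

/-- `w` is a space-periodic classical solution on `[a, b]` of the linear vorticity system whose
velocity is the time-independent field `v`, with source `g` and terminal value `ψ` at `t = b`.
The derivative in time at `t = a` is one-sided. -/
structure IsFrozenVorticitySolution (σ L a b : ℝ) (v : R3 → R3) (g : ℝ → R3 → R3) (ψ : R3 → R3)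
    (w : ℝ → R3 → R3) : Prop where
  continuous_w : ContinuousOn (Function.uncurry w) (Icc a b ×ˢ univ)
  smooth_time : ∀ t ∈ Ico a b, ∀ x,
    DifferentiableWithinAt ℝ (fun s => w s x) (Icc a b) t
  smooth_space : ∀ t ∈ Ico a b, ContDiff ℝ 2 (w t)
  periodic_w : ∀ t ∈ Icc a b, IsPeriodicR3 L (w t)
  equation : ∀ t ∈ Ico a b, ∀ x, ∀ i : Fin 3,
    derivWithin (fun s => w s x i) (Icc a b) t
      + σ ^ 2 / 2 * Laplacian.laplacian (fun y => w t y i) x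
      - advectR3 v (w t) i x + advectR3 (w t) v i x + g t x i = 0
  terminal : ∀ x, w b x = ψ x

end

/-! Write `ω = curl u`, `û` for the velocity frozen at the right end of the step, and `c = σ²/2`.
Taking the curl of the momentum equation removes the pressure and, since `div u = 0`, gives the
vorticity system with velocity `u`. Subtracting the frozen system shows that the error `δ` solves
`∂ₜδ + cΔδ - (û,∇)δ + (δ,∇)û = (u - û,∇)ω - (ω,∇)(u - û)`, with `δ = 0` at the right end.

The right-hand side is `O(h)`: `u` and `∇u` are Lipschitz in time, while `ω` and `∇ω` are bounded.
All these constants come from continuity on a compact set, by periodicity (`exists_uniform_bounds`),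
so they do not depend on the step. The system is parabolic backward in time and coupled only through
the zero-order stretching term, so a maximum principle for `‖δ‖` (`norm_le_of_parabolic_system`)
bounds `δ` by a constant times source size times elapsed time. This supplies the second factor `h`.
-/

/-! ### Calculus of partial derivatives. -/

theorem contDiff_pderivR3 {n : WithTop ℕ∞} {φ : R3 → ℝ} (hφ : ContDiff ℝ (n + 1) φ) (j : Fin 3) :
    ContDiff ℝ n (pderivR3 j φ) :=
  (hφ.fderiv_right le_rfl).clm_apply contDiff_const

theorem pderivR3_add {φ ψ : R3 → ℝ} {x : R3} (hφ : DifferentiableAt ℝ φ x)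
    (hψ : DifferentiableAt ℝ ψ x) (j : Fin 3) :
    pderivR3 j (fun y => φ y + ψ y) x = pderivR3 j φ x + pderivR3 j ψ x := by
  simp [pderivR3, fderiv_fun_add hφ hψ]

theorem pderivR3_sub {φ ψ : R3 → ℝ} {x : R3} (hφ : DifferentiableAt ℝ φ x)
    (hψ : DifferentiableAt ℝ ψ x) (j : Fin 3) :
    pderivR3 j (fun y => φ y - ψ y) x = pderivR3 j φ x - pderivR3 j ψ x := by
  simp [pderivR3, fderiv_fun_sub hφ hψ]

theorem pderivR3_const_mul {φ : R3 → ℝ} {x : R3} (hφ : DifferentiableAt ℝ φ x) (c : ℝ)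
    (j : Fin 3) : pderivR3 j (fun y => c * φ y) x = c * pderivR3 j φ x := by
  simp [pderivR3, fderiv_const_mul hφ]

theorem pderivR3_mul {φ ψ : R3 → ℝ} {x : R3} (hφ : DifferentiableAt ℝ φ x)
    (hψ : DifferentiableAt ℝ ψ x) (j : Fin 3) :
    pderivR3 j (fun y => φ y * ψ y) x = pderivR3 j φ x * ψ x + φ x * pderivR3 j ψ x := by
  simp [pderivR3, fderiv_fun_mul hφ hψ]
  ring

theorem pderivR3_sum {ι : Type*} (s : Finset ι) {φ : ι → R3 → ℝ} {x : R3}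
    (hφ : ∀ i ∈ s, DifferentiableAt ℝ (φ i) x) (j : Fin 3) :
    pderivR3 j (fun y => ∑ i ∈ s, φ i y) x = ∑ i ∈ s, pderivR3 j (φ i) x := by
  simp [pderivR3, fderiv_fun_sum hφ]

theorem pderivR3_comm {φ : R3 → ℝ} (hφ : ContDiff ℝ 2 φ) (i j : Fin 3) (x : R3) :
    pderivR3 i (pderivR3 j φ) x = pderivR3 j (pderivR3 i φ) x := by
  have hd : DifferentiableAt ℝ (fderiv ℝ φ) x :=
    ((hφ.fderiv_right (m := 1) (by norm_num)).differentiable one_ne_zero) x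
  have key : ∀ k l : Fin 3, pderivR3 k (pderivR3 l φ) x
      = fderiv ℝ (fderiv ℝ φ) x (basisVec k) (basisVec l) := by
    intro k l
    change fderiv ℝ (fun y => fderiv ℝ φ y (basisVec l)) x (basisVec k) = _
    rw [fderiv_clm_apply hd (differentiableAt_const _)]
    simp
  rw [key, key]
  exact (hφ.contDiffAt.isSymmSndFDerivAt (by simp)) _ _

theorem laplacian_eq_sum_pderivR3 {φ : R3 → ℝ} (hφ : ContDiff ℝ 2 φ) (x : R3) :
    Laplacian.laplacian φ x = ∑ j, pderivR3 j (pderivR3 j φ) x := by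
  have hd : DifferentiableAt ℝ (fderiv ℝ φ) x :=
    ((hφ.fderiv_right (m := 1) (by norm_num)).differentiable one_ne_zero) x
  rw [InnerProductSpace.laplacian_eq_iteratedFDeriv_orthonormalBasis φ
    (EuclideanSpace.basisFun (Fin 3) ℝ)]
  refine Finset.sum_congr rfl fun j _ => ?_
  change _ = fderiv ℝ (fun y => fderiv ℝ φ y (basisVec j)) x (basisVec j)
  rw [fderiv_clm_apply hd (differentiableAt_const _), iteratedFDeriv_two_apply]
  simp [basisVec]

theorem contDiff_apply_R3 {E : Type*} [NormedAddCommGroup E] [NormedSpace ℝ E]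
    {n : WithTop ℕ∞} {v : E → R3} (hv : ContDiff ℝ n v) (i : Fin 3) :
    ContDiff ℝ n (fun y => v y i) := contDiff_euclidean.1 hv i

/-! ### The curl and the vorticity equation at a fixed time. -/

/-- Indices in `Fin 3` add modulo 3, so this cyclic form treats the three components at once. -/
theorem curlR3_apply (v : R3 → R3) (x : R3) (i : Fin 3) :
    curlR3 v x i = pderivR3 (i + 1) (fun y => v y (i + 2)) x
      - pderivR3 (i + 2) (fun y => v y (i + 1)) x := by
  fin_cases i <;> rfl

theorem contDiff_curlR3 {n : WithTop ℕ∞} {v : R3 → R3} (hv : ContDiff ℝ (n + 1) v) :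
    ContDiff ℝ n (curlR3 v) := by
  refine contDiff_euclidean.2 fun i => ?_
  simp_rw [curlR3_apply]
  exact (contDiff_pderivR3 (contDiff_apply_R3 hv _) _).sub
    (contDiff_pderivR3 (contDiff_apply_R3 hv _) _)

theorem pderivR3_curlR3 {v : R3 → R3} (hv : ContDiff ℝ 2 v) (i j : Fin 3) (x : R3) :
    pderivR3 j (fun y => curlR3 v y i) x
      = pderivR3 j (pderivR3 (i + 1) (fun y => v y (i + 2))) x
        - pderivR3 j (pderivR3 (i + 2) (fun y => v y (i + 1))) x := by
  have h : ∀ k l, Differentiable ℝ (pderivR3 k (fun y => v y l)) := fun k l =>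
    (contDiff_pderivR3 (n := 1) (by simpa [one_add_one_eq_two] using contDiff_apply_R3 hv l)
      k).differentiable one_ne_zero
  simp_rw [curlR3_apply]
  exact pderivR3_sub (h _ _ _) (h _ _ _) j

theorem pderivR3_advectR3 {v : R3 → R3} (hv : ContDiff ℝ 2 v) (i k : Fin 3) (x : R3) :
    pderivR3 k (advectR3 v v i) x
      = ∑ j, (pderivR3 k (fun y => v y j) x * pderivR3 j (fun y => v y i) x
        + v x j * pderivR3 k (pderivR3 j (fun y => v y i)) x) := by
  have h : ∀ k l, Differentiable ℝ (pderivR3 k (fun y => v y l)) := fun k l =>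
    (contDiff_pderivR3 (n := 1) (by simpa [one_add_one_eq_two] using contDiff_apply_R3 hv l)
      k).differentiable one_ne_zero
  have h' : ∀ l, Differentiable ℝ (fun y => v y l) := fun l =>
    (contDiff_apply_R3 hv l).differentiable two_ne_zero
  change pderivR3 k (fun y => ∑ j, v y j * pderivR3 j (fun y => v y i) y) x = _
  rw [pderivR3_sum _ fun j _ => (h' j x).fun_mul (h j i x)]
  exact Finset.sum_congr rfl fun j _ => pderivR3_mul (h' j x) (h j i x) k

theorem pderivR3_laplacian {φ : R3 → ℝ} (hφ : ContDiff ℝ 3 φ) (k : Fin 3) (x : R3) :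
    pderivR3 k (fun y => Laplacian.laplacian φ y) x
      = ∑ j, pderivR3 j (pderivR3 j (pderivR3 k φ)) x := by
  have h2 : ContDiff ℝ 2 φ := hφ.of_le (by norm_num)
  have h1 : ∀ l, ContDiff ℝ 2 (pderivR3 l φ) := fun l =>
    contDiff_pderivR3 (by norm_num; exact hφ) l
  have h0 : ∀ l m, Differentiable ℝ (pderivR3 m (pderivR3 l φ)) := fun l m =>
    (contDiff_pderivR3 (n := 1) (by norm_num; exact h1 l) m).differentiable one_ne_zero
  simp_rw [laplacian_eq_sum_pderivR3 h2]
  rw [pderivR3_sum _ fun j _ => h0 j j x]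
  refine Finset.sum_congr rfl fun j _ => ?_
  rw [pderivR3_comm (h1 j) k j]
  congr 1
  funext y
  exact pderivR3_comm h2 k j y

/-- The curl of the momentum equation of an incompressible flow at a fixed time. -/
theorem vorticity_equation {c : ℝ} {v q F : R3 → R3} {P : R3 → ℝ} (hv : ContDiff ℝ 3 v)
    (hq : ContDiff ℝ 1 q) (hF : ContDiff ℝ 1 F) (hP : ContDiff ℝ 2 P)
    (hdiv : ∀ x, divR3 v x = 0)
    (heq : ∀ x, ∀ i : Fin 3, q x i + c * Laplacian.laplacian (fun y => v y i) x
      - advectR3 v v i x - pderivR3 i P x + F x i = 0) (x : R3) (i : Fin 3) :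
    curlR3 q x i + c * Laplacian.laplacian (fun y => curlR3 v y i) x
      - advectR3 v (curlR3 v) i x + advectR3 (curlR3 v) v i x + curlR3 F x i = 0 := by
  have hv2 : ContDiff ℝ 2 v := hv.of_le (by norm_num)
  have hvi : ∀ i, ContDiff ℝ 3 (fun y => v y i) := contDiff_apply_R3 hv
  have hvi2 : ∀ i, ContDiff ℝ 2 (fun y => v y i) := contDiff_apply_R3 hv2
  have hp1 : ∀ k i, ContDiff ℝ 2 (pderivR3 k (fun y => v y i)) := fun k i =>
    contDiff_pderivR3 (by norm_num; exact hvi i) k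
  have hp2 : ∀ l k i, Differentiable ℝ (pderivR3 l (pderivR3 k (fun y => v y i))) := fun l k i =>
    (contDiff_pderivR3 (n := 1) (by norm_num; exact hp1 k i) l).differentiable one_ne_zero
  have dq : ∀ i, Differentiable ℝ (fun y => q y i) := fun i =>
    (contDiff_apply_R3 hq i).differentiable one_ne_zero
  have dF : ∀ i, Differentiable ℝ (fun y => F y i) := fun i =>
    (contDiff_apply_R3 hF i).differentiable one_ne_zero
  have dP : ∀ i, Differentiable ℝ (pderivR3 i P) := fun i =>
    (contDiff_pderivR3 (n := 1) (by norm_num; exact hP) i).differentiable one_ne_zero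
  have dL : ∀ i, Differentiable ℝ (fun x => Laplacian.laplacian (fun y => v y i) x) := fun i => by
    simp_rw [laplacian_eq_sum_pderivR3 (hvi2 i)]
    exact Differentiable.fun_sum fun j _ => hp2 j j i
  have dA : ∀ i, Differentiable ℝ (advectR3 v v i) := fun i =>
    Differentiable.fun_sum fun j _ => ((hvi j).differentiable three_ne_zero).mul
      ((hp1 j i).differentiable two_ne_zero)
  -- This is `∂ₖ` of the `i`-th momentum equation, with `∂ₖ` commuted to the innermost place in the
  -- second- and third-order velocity terms, so that differences of two instances contain
  -- derivatives of the curl.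
  have key : ∀ k i : Fin 3, pderivR3 k (fun y => q y i) x
      + c * ∑ j, pderivR3 j (pderivR3 j (pderivR3 k (fun y => v y i))) x
      - ∑ j, (pderivR3 k (fun y => v y j) x * pderivR3 j (fun y => v y i) x
        + v x j * pderivR3 j (pderivR3 k (fun y => v y i)) x)
      - pderivR3 k (pderivR3 i P) x + pderivR3 k (fun y => F y i) x = 0 := by
    intro k i
    have h0 : pderivR3 k (fun y => q y i + c * Laplacian.laplacian (fun y => v y i) y
      - advectR3 v v i y - pderivR3 i P y + F y i) x = 0 := by
      simp_rw [heq]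
      simp [pderivR3]
    rw [pderivR3_add (by fun_prop) (dF i x), pderivR3_sub (by fun_prop) (dP i x),
      pderivR3_sub (by fun_prop) (dA i x), pderivR3_add (dq i x) (by fun_prop),
      pderivR3_const_mul (dL i x), pderivR3_laplacian (hvi i),
      pderivR3_advectR3 hv2] at h0
    simp_rw [pderivR3_comm (hvi2 i) k] at h0
    exact h0
  have hlap : Laplacian.laplacian (fun y => curlR3 v y i) x
      = ∑ j, (pderivR3 j (pderivR3 j (pderivR3 (i + 1) (fun y => v y (i + 2)))) x
        - pderivR3 j (pderivR3 j (pderivR3 (i + 2) (fun y => v y (i + 1)))) x) := by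
    rw [laplacian_eq_sum_pderivR3
      (contDiff_apply_R3 (contDiff_curlR3 (n := 2) (by norm_num; exact hv)) i)]
    refine Finset.sum_congr rfl fun j _ => ?_
    rw [← pderivR3_sub (hp2 _ _ _ x) (hp2 _ _ _ x)]
    congr 1
    funext y
    exact pderivR3_curlR3 hv2 i j y
  -- The curl is the difference of `e1` and `e2`. The pressure cancels by symmetry of its second
  -- derivatives (`e4`), and the quadratic terms `∂u ∂u` reduce to stretching plus `(div u) ω`,
  -- which `e3` removes.
  have e1 := key (i + 1) (i + 2)
  have e2 := key (i + 2) (i + 1)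
  have e3 := hdiv x
  have e4 := pderivR3_comm hP (i + 1) (i + 2) x
  rw [hlap]
  simp only [advectR3, pderivR3_curlR3 hv2, divR3, Fin.sum_univ_three] at e1 e2 e3 ⊢
  simp only [curlR3_apply]
  have h11 : (1 : Fin 3) + 1 = 2 := rfl
  have h12 : (1 : Fin 3) + 2 = 0 := rfl
  have h21 : (2 : Fin 3) + 1 = 0 := rfl
  have h22 : (2 : Fin 3) + 2 = 1 := rfl
  fin_cases i <;>
    simp only [Fin.zero_eta, Fin.mk_one, Fin.reduceFinMk, zero_add, h11, h12, h21, h22] at e1 e2 e4 ⊢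
  · linear_combination e1 - e2 + e4 + (pderivR3 1 (fun y => v y 2) x
      - pderivR3 2 (fun y => v y 1) x) * e3
  · linear_combination e1 - e2 + e4 + (pderivR3 2 (fun y => v y 0) x
      - pderivR3 0 (fun y => v y 2) x) * e3
  · linear_combination e1 - e2 + e4 + (pderivR3 0 (fun y => v y 1) x
      - pderivR3 1 (fun y => v y 0) x) * e3

/-! ### Reduction to a compact set and the maximum principle. -/

/-- A lattice shift moves `x` into the cube `[0, L)³`, which lies in the ball of radius `√3 L ≤ 3L`.
The point `y` is chosen before `v`, so one `y` serves every time slice. -/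
theorem IsPeriodicR3.exists_mem_closedBall {L : ℝ} (hL : 0 < L) (x : R3) :
    ∃ y ∈ Metric.closedBall (0 : R3) (3 * L),
      ∀ {F : Type} (v : R3 → F), IsPeriodicR3 L v → v y = v x := by
  set n : Fin 3 → ℤ := fun j => -toIcoDiv hL 0 (x j) with hn
  refine ⟨x + (n 0 • (L • basisVec 0) + n 1 • (L • basisVec 1) + n 2 • (L • basisVec 2)), ?_, ?_⟩
  · have hy : ∀ j : Fin 3, (x + (n 0 • (L • basisVec 0) + n 1 • (L • basisVec 1)
        + n 2 • (L • basisVec 2))) j = toIcoMod hL 0 (x j) := by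
      intro j
      have h := self_sub_toIcoDiv_zsmul hL 0 (x j)
      rw [zsmul_eq_mul] at h
      rw [← h]
      fin_cases j <;> simp [basisVec, hn, -self_sub_toIcoDiv_mul] <;> ring
    have hb : ∀ j, toIcoMod hL 0 (x j) ^ 2 ≤ L ^ 2 := fun j => by
      have h1 := toIcoMod_mem_Ico hL 0 (x j)
      rw [zero_add] at h1
      exact pow_le_pow_left₀ h1.1 h1.2.le 2
    rw [mem_closedBall_zero_iff, EuclideanSpace.norm_eq]
    refine Real.sqrt_le_iff.2 ⟨by positivity, ?_⟩
    simp_rw [hy, Real.norm_eq_abs, sq_abs, Fin.sum_univ_three]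
    nlinarith [hb 0, hb 1, hb 2, sq_nonneg L]
  · intro F v hv
    have h : ∀ j, Function.Periodic v (n j • (L • basisVec j)) := fun j =>
      Function.Periodic.zsmul (hv j) (n j)
    exact ((h 0).add_period (h 1)).add_period (h 2) x

theorem pderivR3_eq_zero_of_max {φ : R3 → ℝ} {x : R3} (hmax : ∀ y, φ y ≤ φ x) (j : Fin 3) :
    pderivR3 j φ x = 0 := by
  have h : IsLocalMax φ x := Filter.Eventually.of_forall hmax
  simp [pderivR3, h.fderiv_eq_zero]

/-- On the line through `x`, a positive second derivative would make the maximum a local minimum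
too; the restriction would then be locally constant, with zero second derivative. -/
theorem pderivR3_pderivR3_nonpos_of_max {φ : R3 → ℝ} (hφ : ContDiff ℝ 2 φ) {x : R3}
    (hmax : ∀ y, φ y ≤ φ x) (j : Fin 3) : pderivR3 j (pderivR3 j φ) x ≤ 0 := by
  have hline : ∀ s : ℝ, HasDerivAt (fun s : ℝ => x + s • basisVec j) (basisVec j) s := fun s => by
    simpa using ((hasDerivAt_id s).smul_const (basisVec j)).const_add x
  have hder : ∀ {χ : R3 → ℝ}, Differentiable ℝ χ → ∀ s : ℝ,
      HasDerivAt (fun s : ℝ => χ (x + s • basisVec j)) (pderivR3 j χ (x + s • basisVec j)) s :=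
    fun hχ s => (hχ _).hasFDerivAt.comp_hasDerivAt s (hline s)
  have hφ1 : Differentiable ℝ (pderivR3 j φ) :=
    (contDiff_pderivR3 (n := 1) (by norm_num; exact hφ) j).differentiable one_ne_zero
  set g : ℝ → ℝ := fun s => φ (x + s • basisVec j) with hg
  have h1 : deriv g = fun s => pderivR3 j φ (x + s • basisVec j) :=
    funext fun s => (hder (hφ.differentiable two_ne_zero) s).deriv
  have h2 : deriv (deriv g) 0 = pderivR3 j (pderivR3 j φ) x := by
    rw [h1, (hder hφ1 0).deriv, zero_smul, add_zero]
  by_contra! hpos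
  rw [← h2] at hpos
  have hgmax : ∀ s, g s ≤ g 0 := fun s => by simpa [hg] using hmax _
  have hmin : IsLocalMin g 0 := isLocalMin_of_deriv_deriv_pos hpos
    (by rw [h1]; simpa using pderivR3_eq_zero_of_max hmax j)
    (hder (hφ.differentiable two_ne_zero) 0).continuousAt
  have hconst : g =ᶠ[nhds 0] fun _ => g 0 := hmin.mono fun s hs => le_antisymm (hgmax s) hs
  have : deriv (deriv g) 0 = 0 := by
    rw [hconst.deriv.deriv_eq]
    simp
  linarith

/-- Since `t < b`, moving forward in time is admissible even at `t = a`, and the one-sided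
derivative in that direction cannot be positive at a maximum. -/
theorem derivWithin_nonpos_of_max {a b t d : ℝ} {ψ : ℝ → ℝ} (ht : t ∈ Ico a b)
    (hd : HasDerivWithinAt ψ d (Icc a b) t) (hmax : ∀ s ∈ Icc a b, ψ s ≤ ψ t) : d ≤ 0 := by
  have hloc : IsLocalMaxOn ψ (Icc a b) t := Filter.eventually_of_mem self_mem_nhdsWithin hmax
  have hcone : b - t ∈ posTangentConeAt (Icc a b) t := by
    refine sub_mem_posTangentConeAt_of_segment_subset ?_
    rw [segment_eq_Icc ht.2.le]
    exact Icc_subset_Icc_left ht.1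
  have h := hloc.hasFDerivWithinAt_nonpos hd.hasFDerivWithinAt hcone
  simp at h
  nlinarith [sub_pos.2 ht.2]

theorem abs_apply_le_norm (d : R3) (i : Fin 3) : |d i| ≤ ‖d‖ := by
  simpa using PiLp.norm_apply_le d i

theorem sum_mul_apply_le (d y : R3) : ∑ i, d i * y i ≤ ‖d‖ * ‖y‖ := by
  have h := real_inner_le_norm d y
  simpa [PiLp.inner_apply, mul_comm] using h

theorem sum_mul_self_apply (d : R3) : ∑ i, d i * d i = ‖d‖ ^ 2 := by
  rw [EuclideanSpace.norm_sq_eq]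
  simp [sq]

theorem abs_advectR3_le {y v : R3 → R3} {Y M : ℝ} {x : R3} (hY : 0 ≤ Y)
    (hy : ∀ j, |y x j| ≤ Y) (i : Fin 3)
    (hv : ∀ j, |pderivR3 j (fun z => v z i) x| ≤ M) : |advectR3 y v i x| ≤ 3 * (Y * M) := by
  refine (Finset.abs_sum_le_sum_abs _ _).trans ?_
  refine (Finset.sum_le_card_nsmul _ _ (Y * M) fun j _ => ?_).trans (by simp)
  rw [abs_mul]
  exact mul_le_mul (hy j) (hv j) (abs_nonneg _) hY

/-- A maximum principle for backward parabolic systems whose principal part is diagonal. -/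
theorem norm_le_of_parabolic_system {c L a b B M : ℝ} (hc : 0 ≤ c) (hL : 0 < L)
    (hB : 0 ≤ B) (hM : 0 ≤ M) {v : R3 → R3} {δ : ℝ → R3 → R3}
    (hv : ∀ i j x, |pderivR3 j (fun y => v y i) x| ≤ M)
    (hcont : ContinuousOn (Function.uncurry δ) (Icc a b ×ˢ univ))
    (htime : ∀ t ∈ Ico a b, ∀ x i, DifferentiableWithinAt ℝ (fun s => δ s x i) (Icc a b) t)
    (hspace : ∀ t ∈ Ico a b, ContDiff ℝ 2 (δ t))
    (hper : ∀ t ∈ Icc a b, IsPeriodicR3 L (δ t))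
    (heq : ∀ t ∈ Ico a b, ∀ x, ∀ i : Fin 3,
      |derivWithin (fun s => δ s x i) (Icc a b) t
        + c * Laplacian.laplacian (fun y => δ t y i) x
        - advectR3 v (δ t) i x + advectR3 (δ t) v i x| ≤ B)
    (hterm : ∀ x, δ b x = 0) {t : ℝ} (ht : t ∈ Icc a b) (x : R3) :
    ‖δ t x‖ ≤ 3 * B * (b - t) * Real.exp ((9 * M + 1) * (b - t)) := by
  -- The aim is `G ≤ 0`. In the rate `l`, `9M` absorbs the stretching term (three components, each
  -- at most `3M‖d‖²`) and the extra `1` makes the final contradiction strict. The `3B` sums the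
  -- source over three components.
  set l : ℝ := 9 * M + 1 with hl
  set G : ℝ × R3 → ℝ := fun z =>
    Real.exp (-(l * (b - z.1))) * ‖δ z.1 z.2‖ - 3 * B * (b - z.1) with hG
  have hcontG : ContinuousOn G (Icc a b ×ˢ univ) := by
    have : ContinuousOn (fun z : ℝ × R3 => δ z.1 z.2) (Icc a b ×ˢ univ) := hcont
    fun_prop
  obtain ⟨y, hy, hyx⟩ := IsPeriodicR3.exists_mem_closedBall hL x
  obtain ⟨⟨t₀, x₀⟩, ⟨ht₀, -⟩, hmax⟩ :=
    (isCompact_Icc.prod (isCompact_closedBall (0 : R3) (3 * L))).exists_isMaxOn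
      ⟨(t, y), ht, hy⟩ (hcontG.mono (prod_mono_right (subset_univ _)))
  have hmax' : ∀ s ∈ Icc a b, ∀ z, G (s, z) ≤ G (t₀, x₀) := by
    intro s hs z
    obtain ⟨z', hz', hzz⟩ := IsPeriodicR3.exists_mem_closedBall hL z
    have : G (s, z') = G (s, z) := by simp only [hG, hzz (δ s) (hper s hs)]
    rw [← this]
    exact hmax ⟨hs, hz'⟩
  have hG0 : G (t₀, x₀) ≤ 0 := by
    by_contra! hpos
    have ht₀b : t₀ < b := by
      refine lt_of_le_of_ne ht₀.2 fun h => ?_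
      simp [hG, h, hterm] at hpos
    have ht₀' : t₀ ∈ Ico a b := ⟨ht₀.1, ht₀b⟩
    set d : R3 := δ t₀ x₀ with hd
    set E : ℝ := Real.exp (-(l * (b - t₀))) with hE
    have hE0 : 0 < E := Real.exp_pos _
    have hE1 : E ≤ 1 := Real.exp_le_one_iff.2 (by
      have : 0 ≤ l * (b - t₀) := mul_nonneg (by positivity) (by linarith)
      linarith)
    have hN : 0 < ‖d‖ := by
      have h1 : 0 < E * ‖d‖ - 3 * B * (b - t₀) := hpos
      have h2 : 0 ≤ 3 * B * (b - t₀) := mul_nonneg (by positivity) (by linarith)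
      by_contra! h3
      nlinarith
    have hδC : ∀ i, ContDiff ℝ 2 (fun y => δ t₀ y i) := contDiff_apply_R3 (hspace t₀ ht₀')
    have hδD : ∀ i, Differentiable ℝ (fun y => δ t₀ y i) := fun i =>
      (hδC i).differentiable two_ne_zero
    have hδp : ∀ i j, Differentiable ℝ (pderivR3 j (fun y => δ t₀ y i)) := fun i j =>
      (contDiff_pderivR3 (n := 1) (by norm_num; exact hδC i) j).differentiable one_ne_zero
    -- To avoid differentiating the norm, freeze the direction `d = δ t₀ x₀`. By Cauchy–Schwarz the
    -- smooth scalar `⟨d, δ t₀ ·⟩` is maximal at `x₀`, so its gradient vanishes there and its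
    -- Laplacian is nonpositive.
    have hφC : ContDiff ℝ 2 (fun y => ∑ i, d i * δ t₀ y i) :=
      ContDiff.sum fun i _ => contDiff_const.mul (hδC i)
    have hφmax : ∀ y, ∑ i, d i * δ t₀ y i ≤ ∑ i, d i * δ t₀ x₀ i := by
      intro y
      refine (sum_mul_apply_le d (δ t₀ y)).trans ?_
      rw [← hd, sum_mul_self_apply, sq]
      have h1 : E * ‖δ t₀ y‖ - 3 * B * (b - t₀) ≤ E * ‖d‖ - 3 * B * (b - t₀) := hmax' t₀ ht₀ y
      have h2 : ‖δ t₀ y‖ ≤ ‖d‖ := le_of_mul_le_mul_left (by linarith) hE0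
      exact mul_le_mul_of_nonneg_left h2 hN.le
    have hφp : ∀ j, pderivR3 j (fun y => ∑ i, d i * δ t₀ y i)
        = fun y => ∑ i, d i * pderivR3 j (fun y => δ t₀ y i) y := fun j => by
      funext y
      rw [pderivR3_sum _ fun i _ => (hδD i y).const_mul _]
      exact Finset.sum_congr rfl fun i _ => pderivR3_const_mul (hδD i y) _ _
    have hgrad : ∀ j, ∑ i, d i * pderivR3 j (fun y => δ t₀ y i) x₀ = 0 := fun j => by
      rw [← pderivR3_eq_zero_of_max hφmax j, hφp]
    have hlap : ∑ i, d i * Laplacian.laplacian (fun y => δ t₀ y i) x₀ ≤ 0 := by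
      have h1 : ∀ j, ∑ i, d i * pderivR3 j (pderivR3 j (fun y => δ t₀ y i)) x₀ ≤ 0 := fun j => by
        refine le_of_eq_of_le ?_ (pderivR3_pderivR3_nonpos_of_max hφC hφmax j)
        rw [hφp, pderivR3_sum _ fun i _ => (hδp i j x₀).const_mul _]
        exact Finset.sum_congr rfl fun i _ => (pderivR3_const_mul (hδp i j x₀) _ _).symm
      simp_rw [laplacian_eq_sum_pderivR3 (hδC _), Finset.mul_sum]
      rw [Finset.sum_comm]
      exact Finset.sum_nonpos fun j _ => h1 j
    have hadv : ∑ i, d i * advectR3 v (δ t₀) i x₀ = 0 := by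
      simp_rw [advectR3, Finset.mul_sum]
      rw [Finset.sum_comm]
      refine Finset.sum_eq_zero fun j _ => ?_
      rw [← mul_zero (v x₀ j), ← hgrad j, Finset.mul_sum]
      exact Finset.sum_congr rfl fun i _ => by ring
    have hstretch : ∀ i, d i * advectR3 (δ t₀) v i x₀ ≤ 3 * M * ‖d‖ ^ 2 := fun i => by
      have h1 := abs_advectR3_le (y := δ t₀) hN.le (abs_apply_le_norm d) i (fun j => hv i j x₀)
      refine (le_abs_self _).trans ?_
      rw [abs_mul]
      nlinarith [mul_le_mul (abs_apply_le_norm d i) h1 (abs_nonneg _) hN.le]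
    have htd : -(9 * M * ‖d‖ ^ 2 + 3 * B * ‖d‖)
        ≤ ∑ i, d i * derivWithin (fun s => δ s x₀ i) (Icc a b) t₀ := by
      have h1 : ∀ i, -(‖d‖ * B) ≤ d i * (derivWithin (fun s => δ s x₀ i) (Icc a b) t₀
          + c * Laplacian.laplacian (fun y => δ t₀ y i) x₀
          - advectR3 v (δ t₀) i x₀ + advectR3 (δ t₀) v i x₀) := fun i => by
        refine neg_le_of_abs_le ?_
        rw [abs_mul]
        exact mul_le_mul (abs_apply_le_norm d i) (heq t₀ ht₀' x₀ i) (abs_nonneg _) hN.le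
      have e0 := h1 0
      have e1 := h1 1
      have e2 := h1 2
      have f0 := hstretch 0
      have f1 := hstretch 1
      have f2 := hstretch 2
      have h3 := mul_nonpos_of_nonneg_of_nonpos hc hlap
      rw [Fin.sum_univ_three] at h3 hadv ⊢
      linarith
    -- The same linearisation in time: this function is at most `‖d‖ * G (s, x₀)`, with equality at
    -- `t₀`, so it is maximal there. Yet `htd` and `E ≤ 1` bound its derivative below by `E‖d‖² >
    -- 0`.
    have hder : HasDerivWithinAt
        (fun s => Real.exp (-(l * (b - s))) * (∑ i, d i * δ s x₀ i) - ‖d‖ * (3 * B * (b - s)))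
        ((E * l) * (∑ i, d i * δ t₀ x₀ i)
          + E * (∑ i, d i * derivWithin (fun s => δ s x₀ i) (Icc a b) t₀) + ‖d‖ * (3 * B))
        (Icc a b) t₀ := by
      have h0 : HasDerivWithinAt (fun s : ℝ => b - s) (-1) (Icc a b) t₀ :=
        (hasDerivWithinAt_id _ _).const_sub b
      have h1 := (h0.const_mul l).neg.exp
      have h2 : HasDerivWithinAt (fun s => ∑ i, d i * δ s x₀ i)
          (∑ i, d i * derivWithin (fun s => δ s x₀ i) (Icc a b) t₀) (Icc a b) t₀ :=
        HasDerivWithinAt.fun_sum fun i _ =>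
          ((htime t₀ ht₀' x₀ i).hasDerivWithinAt).const_mul (d i)
      refine ((h1.mul h2).sub ((h0.const_mul (3 * B)).const_mul ‖d‖)).congr_deriv ?_
      simp [hE]
    have hle := derivWithin_nonpos_of_max ht₀' hder fun s hs => by
      have h1 : Real.exp (-(l * (b - s))) * ‖δ s x₀‖ - 3 * B * (b - s)
        ≤ E * ‖d‖ - 3 * B * (b - t₀) := hmax' s hs x₀
      have h2 := mul_le_mul_of_nonneg_left (sum_mul_apply_le d (δ s x₀))
        (Real.exp_pos (-(l * (b - s)))).le
      rw [← hd, ← hE, sum_mul_self_apply]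
      nlinarith [mul_le_mul_of_nonneg_left h1 hN.le]
    rw [← hd, sum_mul_self_apply] at hle
    have h3 := mul_le_mul_of_nonneg_left htd hE0.le
    have h4 : 0 < E * ‖d‖ ^ 2 := by positivity
    have h5 : 0 ≤ 3 * B * ‖d‖ * (1 - E) := mul_nonneg (by positivity) (by linarith)
    rw [hl] at hle
    nlinarith
  have hfin : Real.exp (-(l * (b - t))) * ‖δ t x‖ - 3 * B * (b - t) ≤ 0 :=
    (hmax' t ht x).trans hG0
  have hexp : Real.exp (-(l * (b - t))) * Real.exp (l * (b - t)) = 1 := by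
    rw [← Real.exp_add]; simp
  have := mul_le_mul_of_nonneg_right (sub_nonpos.1 hfin) (Real.exp_pos (l * (b - t))).le
  calc ‖δ t x‖ = Real.exp (-(l * (b - t))) * ‖δ t x‖ * Real.exp (l * (b - t)) := by
        rw [mul_right_comm, hexp, one_mul]
    _ ≤ _ := this

/-! ### Periodic functions on the closed space-time slab. -/

/-- The space-time slab `[0, T] × ℝ³`. -/
abbrev slabR3 (T : ℝ) : Set (ℝ × R3) := Icc 0 T ×ˢ univ

/-- The derivative in the direction `e` within `[0, T] × ℝ³`, one-sided in time at the ends. -/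
noncomputable def slabDeriv (T : ℝ) (e : ℝ × R3) (G : ℝ × R3 → ℝ) (z : ℝ × R3) : ℝ :=
  fderivWithin ℝ G (slabR3 T) z e

/-- `G` is `C^n` on `[0, T] × ℝ³` and `L`-periodic in each space direction. -/
structure IsPeriodicContDiff (L T : ℝ) (n : WithTop ℕ∞) (G : ℝ × R3 → ℝ) : Prop where
  contDiffOn : ContDiffOn ℝ n G (slabR3 T)
  periodic : ∀ t ∈ Icc 0 T, IsPeriodicR3 L (fun x => G (t, x))

theorem uniqueDiffOn_slabR3 {T : ℝ} (hT : 0 < T) : UniqueDiffOn ℝ (slabR3 T) :=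
  (uniqueDiffOn_Icc hT).prod uniqueDiffOn_univ

/-- The slab is the closure of its interior, so symmetry of second derivatives extends to the end
times. -/
theorem slabDeriv_comm {T : ℝ} (hT : 0 < T) {G : ℝ × R3 → ℝ} (hG : ContDiffOn ℝ 2 G (slabR3 T))
    (d e : ℝ × R3) {z : ℝ × R3} (hz : z ∈ slabR3 T) :
    slabDeriv T d (slabDeriv T e G) z = slabDeriv T e (slabDeriv T d G) z := by
  have hU := uniqueDiffOn_slabR3 hT
  have hd : DifferentiableWithinAt ℝ (fderivWithin ℝ G (slabR3 T)) (slabR3 T) z :=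
    ((hG.fderivWithin hU (m := 1) (by norm_num)).differentiableOn one_ne_zero) z hz
  have key : ∀ k l : ℝ × R3, slabDeriv T k (slabDeriv T l G) z
      = fderivWithin ℝ (fderivWithin ℝ G (slabR3 T)) (slabR3 T) z k l := by
    intro k l
    change fderivWithin ℝ (fun y => fderivWithin ℝ G (slabR3 T) y l) (slabR3 T) z k = _
    rw [fderivWithin_clm_apply (hU z hz) hd (differentiableWithinAt_const _)]
    simp
  rw [key, key]
  refine (hG z hz).isSymmSndFDerivWithinAt (by simp) hU ?_ hz _ _
  rw [interior_prod_eq, interior_Icc, interior_univ, closure_prod_eq, closure_Ioo hT.ne,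
    closure_univ]
  exact hz

theorem pderivR3_slice {T t : ℝ} (ht : t ∈ Icc 0 T) {G : ℝ × R3 → ℝ}
    (hG : DifferentiableOn ℝ G (slabR3 T)) (j : Fin 3) (x : R3) :
    pderivR3 j (fun y => G (t, y)) x = slabDeriv T (0, basisVec j) G (t, x) := by
  have h1 := (hG (t, x) ⟨ht, mem_univ x⟩).hasFDerivWithinAt
  have h2 : HasFDerivWithinAt (fun y : R3 => (t, y)) (ContinuousLinearMap.inr ℝ ℝ R3) univ x :=
    (hasFDerivAt_prodMk_right t x).hasFDerivWithinAt
  have h3 := (h1.comp x h2 fun y _ => ⟨ht, mem_univ y⟩).hasFDerivAt Filter.univ_mem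
  change fderiv ℝ (G ∘ fun y => (t, y)) x (basisVec j) = _
  rw [h3.fderiv]
  simp [slabDeriv]

theorem hasDerivWithinAt_slice {T t : ℝ} (ht : t ∈ Icc 0 T) {G : ℝ × R3 → ℝ}
    (hG : DifferentiableOn ℝ G (slabR3 T)) (x : R3) :
    HasDerivWithinAt (fun s => G (s, x)) (slabDeriv T (1, 0) G (t, x)) (Icc 0 T) t := by
  have h1 := (hG (t, x) ⟨ht, mem_univ x⟩).hasFDerivWithinAt
  have h2 : HasFDerivWithinAt (fun s : ℝ => (s, x)) (ContinuousLinearMap.inl ℝ ℝ R3)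
      (Icc 0 T) t := (hasFDerivAt_prodMk_left t x).hasFDerivWithinAt
  have h3 := (h1.comp t h2 fun _ hs => mk_mem_prod hs (mem_univ x)).hasDerivWithinAt
  refine HasDerivWithinAt.congr_deriv h3 ?_
  simp [slabDeriv]

theorem contDiff_slice {T t : ℝ} (ht : t ∈ Icc 0 T) {n : WithTop ℕ∞} {G : ℝ × R3 → ℝ}
    (hG : ContDiffOn ℝ n G (slabR3 T)) : ContDiff ℝ n (fun y => G (t, y)) :=
  contDiffOn_univ.1 (hG.comp (contDiff_prodMk_right t).contDiffOn fun y _ => ⟨ht, mem_univ y⟩)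

namespace IsPeriodicContDiff

variable {L T : ℝ} {n : WithTop ℕ∞} {G H : ℝ × R3 → ℝ}

theorem sub (hG : IsPeriodicContDiff L T n G) (hH : IsPeriodicContDiff L T n H) :
    IsPeriodicContDiff L T n (fun z => G z - H z) :=
  ⟨hG.contDiffOn.sub hH.contDiffOn, fun t ht j x => by
    simpa using congrArg₂ (· - ·) (hG.periodic t ht j x) (hH.periodic t ht j x)⟩

theorem slabDeriv {m : WithTop ℕ∞} (hT : 0 < T) (hG : IsPeriodicContDiff L T m G)
    (hn : n + 1 ≤ m) (e : ℝ × R3) :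
    IsPeriodicContDiff L T n (slabDeriv T e G) := by
  have hU := uniqueDiffOn_slabR3 hT
  refine ⟨(hG.contDiffOn.fderivWithin hU hn).clm_apply contDiffOn_const, fun t ht j x => ?_⟩
  have hd : DifferentiableOn ℝ G (slabR3 T) := hG.contDiffOn.differentiableOn fun h => by simp [h] at hn
  -- Translation by `a` preserves both the slab and `G`, so the derivatives at `(t, x)` and `(t, x)
  -- + a` agree by uniqueness of the derivative within the slab.
  set a : ℝ × R3 := (0, L • basisVec j) with ha
  have hmaps : MapsTo (fun z => z + a) (slabR3 T) (slabR3 T) := fun z hz =>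
    ⟨by simpa [ha] using hz.1, mem_univ _⟩
  have hz : (t, x) ∈ slabR3 T := ⟨ht, mem_univ x⟩
  have h1 := (hd _ (hmaps hz)).hasFDerivWithinAt.comp (t, x)
    ((hasFDerivWithinAt_id (𝕜 := ℝ) (t, x) (slabR3 T)).add_const a) hmaps
  have h2 : HasFDerivWithinAt G (fderivWithin ℝ G (slabR3 T) ((t, x) + a)) (slabR3 T) (t, x) := by
    refine h1.congr (fun z hz => ?_) ?_
    · obtain ⟨r, y⟩ := z
      simpa [ha] using (hG.periodic r hz.1 j y).symm
    · simpa [ha] using (hG.periodic t ht j x).symm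
  have h3 := h2.fderivWithin (hU _ hz)
  simp only [ha, Prod.mk_add_mk, add_zero] at h3
  simp only [_root_.slabDeriv, h3]

theorem exists_abs_le (hL : 0 < L) (hG : IsPeriodicContDiff L T n G) :
    ∃ M, 0 ≤ M ∧ ∀ t ∈ Icc 0 T, ∀ x, |G (t, x)| ≤ M := by
  obtain ⟨M, hM⟩ := (isCompact_Icc.prod
    (isCompact_closedBall (0 : R3) (3 * L))).exists_bound_of_continuousOn
      (hG.contDiffOn.continuousOn.mono (prod_mono_right (subset_univ _)))
  refine ⟨|M|, abs_nonneg M, fun t ht x => ?_⟩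
  obtain ⟨y, hy, hyx⟩ := IsPeriodicR3.exists_mem_closedBall hL x
  rw [← hyx _ (hG.periodic t ht)]
  exact (hM (t, y) ⟨ht, hy⟩).trans (le_abs_self M)

/-- The time derivative is continuous and periodic, hence bounded; the mean value inequality then
gives a Lipschitz constant uniform in `x`. -/
theorem exists_abs_sub_le (hL : 0 < L) (hT : 0 < T) (hG : IsPeriodicContDiff L T 1 G) :
    ∃ M, 0 ≤ M ∧ ∀ s ∈ Icc 0 T, ∀ t ∈ Icc 0 T, ∀ x, |G (t, x) - G (s, x)| ≤ M * |t - s| := by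
  obtain ⟨M, hM0, hM⟩ := exists_abs_le hL (slabDeriv (n := 0) hT hG (by simp) (1, 0))
  refine ⟨M, hM0, fun s hs t ht x => ?_⟩
  exact (convex_Icc 0 T).norm_image_sub_le_of_norm_hasDerivWithin_le
    (fun r hr => hasDerivWithinAt_slice hr (hG.contDiffOn.differentiableOn one_ne_zero) x)
    (fun r hr => hM r hr x) hs ht

end IsPeriodicContDiff

/-! ### Regularity and evolution of the vorticity. -/

namespace IsNSESolution

variable {σ L T : ℝ} {f : ℝ → R3 → R3} {φ : R3 → R3} {u : ℝ → R3 → R3} {p : ℝ → R3 → ℝ}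

theorem isPeriodicContDiff_velocity (hu : IsNSESolution σ L T f φ u p) (i : Fin 3) :
    IsPeriodicContDiff L T 3 (fun z => u z.1 z.2 i) :=
  ⟨contDiffOn_euclidean.1 hu.smooth_u i, fun t ht j x => by simp [hu.periodic_u t ht j x]⟩

theorem contDiff_velocity (hu : IsNSESolution σ L T f φ u p) {t : ℝ} (ht : t ∈ Icc 0 T) :
    ContDiff ℝ 3 (u t) :=
  contDiff_euclidean.2 fun i => contDiff_slice ht (hu.isPeriodicContDiff_velocity i).contDiffOn

/-- Slicewise derivatives agree with derivatives within the slab only on the slab; a function `G`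
matching them there carries the joint regularity in time and space. -/
theorem exists_isPeriodicContDiff_gradient (hu : IsNSESolution σ L T f φ u p) (hT : 0 < T)
    (i j : Fin 3) : ∃ G, IsPeriodicContDiff L T 2 G ∧
      ∀ t ∈ Icc 0 T, ∀ x, G (t, x) = pderivR3 j (fun y => u t y i) x := by
  have h := hu.isPeriodicContDiff_velocity i
  refine ⟨_, h.slabDeriv (n := 2) hT (by norm_num) (0, basisVec j), fun t ht x => ?_⟩
  exact (pderivR3_slice ht (h.contDiffOn.differentiableOn three_ne_zero) j x).symm

theorem exists_isPeriodicContDiff_vorticity (hu : IsNSESolution σ L T f φ u p) (hT : 0 < T)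
    (i : Fin 3) : ∃ G, IsPeriodicContDiff L T 2 G ∧
      ∀ t ∈ Icc 0 T, ∀ x, G (t, x) = curlR3 (u t) x i := by
  obtain ⟨G, hG, hGu⟩ := hu.exists_isPeriodicContDiff_gradient hT (i + 2) (i + 1)
  obtain ⟨H, hH, hHu⟩ := hu.exists_isPeriodicContDiff_gradient hT (i + 1) (i + 2)
  exact ⟨_, hG.sub hH, fun t ht x => by rw [hGu t ht, hHu t ht, curlR3_apply]⟩

theorem exists_isPeriodicContDiff_vorticity_gradient (hu : IsNSESolution σ L T f φ u p)
    (hT : 0 < T) (i j : Fin 3) : ∃ G, IsPeriodicContDiff L T 1 G ∧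
      ∀ t ∈ Icc 0 T, ∀ x, G (t, x) = pderivR3 j (fun y => curlR3 (u t) y i) x := by
  obtain ⟨G, hG, hGu⟩ := hu.exists_isPeriodicContDiff_vorticity hT i
  refine ⟨_, hG.slabDeriv (n := 1) hT (by norm_num) (0, basisVec j), fun t ht x => ?_⟩
  rw [← pderivR3_slice ht (hG.contDiffOn.differentiableOn two_ne_zero) j x]
  simp_rw [hGu t ht]

/-- The time derivative of `curl u` is the curl of `q = ∂ₜu`, because mixed slab derivatives
commute, also at `t = 0`. The fixed-time identity then applies with this `q`. -/
theorem vorticity_equation (hu : IsNSESolution σ L T f φ u p) (hT : 0 < T) {t : ℝ}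
    (ht : t ∈ Ico 0 T) (x : R3) (i : Fin 3) :
    ∃ d, HasDerivWithinAt (fun s => curlR3 (u s) x i) d (Icc 0 T) t ∧
      d + σ ^ 2 / 2 * Laplacian.laplacian (fun y => curlR3 (u t) y i) x
        - advectR3 (u t) (curlR3 (u t)) i x + advectR3 (curlR3 (u t)) (u t) i x
        + curlR3 (f t) x i = 0 := by
  have ht' : t ∈ Icc 0 T := Ico_subset_Icc_self ht
  set U : Fin 3 → ℝ × R3 → ℝ := fun i z => u z.1 z.2 i with hU
  have hU3 : ∀ i, IsPeriodicContDiff L T 3 (U i) := hu.isPeriodicContDiff_velocity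
  have hU2 : ∀ i e, IsPeriodicContDiff L T 2 (slabDeriv T e (U i)) := fun i e =>
    (hU3 i).slabDeriv (n := 2) hT (by norm_num) e
  have hUd : ∀ i, DifferentiableOn ℝ (U i) (slabR3 T) := fun i =>
    (hU3 i).contDiffOn.differentiableOn three_ne_zero
  have hUd' : ∀ i e, DifferentiableOn ℝ (slabDeriv T e (U i)) (slabR3 T) := fun i e =>
    (hU2 i e).contDiffOn.differentiableOn two_ne_zero
  set q : R3 → R3 := fun y => WithLp.toLp 2 fun i => slabDeriv T (1, 0) (U i) (t, y) with hq
  have hq1 : ContDiff ℝ 1 q := contDiff_euclidean.2 fun i =>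
    contDiff_slice ht' ((hU2 i (1, 0)).contDiffOn.of_le (by norm_num))
  refine ⟨curlR3 q x i, ?_, ?_⟩
  · have h1 := (hasDerivWithinAt_slice ht' (hUd' (i + 2) (0, basisVec (i + 1))) x).sub
      (hasDerivWithinAt_slice ht' (hUd' (i + 1) (0, basisVec (i + 2))) x)
    have hz : (t, x) ∈ slabR3 T := ⟨ht', mem_univ x⟩
    have hc : ∀ k l, slabDeriv T (1, 0) (slabDeriv T (0, basisVec k) (U l)) (t, x)
        = pderivR3 k (fun y => q y l) x := fun k l => by
      rw [slabDeriv_comm hT ((hU3 l).contDiffOn.of_le (by norm_num)) _ _ hz,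
        ← pderivR3_slice ht' (hUd' l (1, 0))]
    rw [hc, hc, ← curlR3_apply] at h1
    have h2 : ∀ s ∈ Icc 0 T, curlR3 (u s) x i = slabDeriv T (0, basisVec (i + 1)) (U (i + 2)) (s, x)
        - slabDeriv T (0, basisVec (i + 2)) (U (i + 1)) (s, x) := fun s hs => by
      rw [curlR3_apply, ← pderivR3_slice hs (hUd _), ← pderivR3_slice hs (hUd _)]
    exact h1.congr h2 (h2 t ht')
  · refine _root_.vorticity_equation (hu.contDiff_velocity ht') hq1 (hu.smooth_f t ht)
      (hu.smooth_p t ht) (hu.div_u t ht') (fun y k => ?_) x i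
    rw [← hu.momentum t ht y k]
    congr 4
    exact ((hasDerivWithinAt_slice ht' (hUd k) y).derivWithin
      (uniqueDiffOn_Icc hT t ht')).symm

end IsNSESolution

/-! ### The error equation and the one-step estimate. -/

theorem advectR3_sub_left (a b v : R3 → R3) (i : Fin 3) (x : R3) :
    advectR3 (fun y => a y - b y) v i x = advectR3 a v i x - advectR3 b v i x := by
  simp [advectR3, sub_mul, Finset.sum_sub_distrib]

theorem advectR3_sub_right (a : R3 → R3) {v w : R3 → R3} {x : R3} (i : Fin 3)
    (hv : DifferentiableAt ℝ (fun y => v y i) x) (hw : DifferentiableAt ℝ (fun y => w y i) x) :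
    advectR3 a (fun y => v y - w y) i x = advectR3 a v i x - advectR3 a w i x := by
  simp [advectR3, pderivR3_sub hv hw, mul_sub, Finset.sum_sub_distrib]

theorem laplacian_sub_apply {v w : R3 → R3} (hv : ContDiff ℝ 2 v) (hw : ContDiff ℝ 2 w)
    (i : Fin 3) (x : R3) :
    Laplacian.laplacian (fun y => (v y - w y) i) x
      = Laplacian.laplacian (fun y => v y i) x - Laplacian.laplacian (fun y => w y i) x :=
  (contDiff_apply_R3 hv i).contDiffAt.laplacian_sub (contDiff_apply_R3 hw i).contDiffAt

theorem isPeriodicR3_curlR3 {L : ℝ} {v : R3 → R3} (hv : IsPeriodicR3 L v) :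
    IsPeriodicR3 L (curlR3 v) := by
  intro j x
  have h : ∀ k i, pderivR3 k (fun y => v y i) (x + L • basisVec j)
      = pderivR3 k (fun y => v y i) x := fun k i => by
    rw [pderivR3, ← fderiv_comp_add_right]
    simp_rw [hv j]
    rfl
  simp only [curlR3, h]

namespace IsNSESolution

variable {σ L T : ℝ} {f : ℝ → R3 → R3} {φ : R3 → R3} {u : ℝ → R3 → R3} {p : ℝ → R3 → ℝ}

theorem continuousOn_vorticity (hu : IsNSESolution σ L T f φ u p) (hT : 0 < T) :
    ContinuousOn (fun z : ℝ × R3 => curlR3 (u z.1) z.2) (slabR3 T) := by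
  have h : ∀ i, ContinuousOn (fun z : ℝ × R3 => curlR3 (u z.1) z.2 i) (slabR3 T) := fun i => by
    obtain ⟨G, hG, hGu⟩ := hu.exists_isPeriodicContDiff_vorticity hT i
    exact hG.contDiffOn.continuousOn.congr fun z hz => (hGu z.1 hz.1 z.2).symm
  exact (PiLp.continuous_toLp 2 _).comp_continuousOn (continuousOn_pi.2 h)

/-- Uniform bounds for the velocity and the vorticity of a classical periodic solution. -/
theorem exists_uniform_bounds (hu : IsNSESolution σ L T f φ u p) (hL : 0 < L) (hT : 0 < T) :
    ∃ M, 0 ≤ M ∧ ∀ t ∈ Icc 0 T, ∀ x, ∀ i : Fin 3, |curlR3 (u t) x i| ≤ M ∧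
      (∀ j, |pderivR3 j (fun y => u t y i) x| ≤ M) ∧
      (∀ j, |pderivR3 j (fun y => curlR3 (u t) y i) x| ≤ M) ∧
      ∀ s ∈ Icc 0 T, |u t x i - u s x i| ≤ M * |t - s| ∧
        ∀ j, |pderivR3 j (fun y => u t y i) x - pderivR3 j (fun y => u s y i) x| ≤ M * |t - s| := by
  have h1 : ∀ i : Fin 3, ∃ M, 0 ≤ M ∧ ∀ t ∈ Icc 0 T, ∀ x, |curlR3 (u t) x i| ≤ M := fun i => by
    obtain ⟨G, hG, hGu⟩ := hu.exists_isPeriodicContDiff_vorticity hT i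
    obtain ⟨M, hM0, hM⟩ := hG.exists_abs_le hL
    exact ⟨M, hM0, fun t ht x => hGu t ht x ▸ hM t ht x⟩
  have h2 : ∀ i j : Fin 3, ∃ M, 0 ≤ M ∧ ∀ t ∈ Icc 0 T, ∀ x,
      |pderivR3 j (fun y => u t y i) x| ≤ M := fun i j => by
    obtain ⟨G, hG, hGu⟩ := hu.exists_isPeriodicContDiff_gradient hT i j
    obtain ⟨M, hM0, hM⟩ := hG.exists_abs_le hL
    exact ⟨M, hM0, fun t ht x => hGu t ht x ▸ hM t ht x⟩
  have h3 : ∀ i j : Fin 3, ∃ M, 0 ≤ M ∧ ∀ t ∈ Icc 0 T, ∀ x,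
      |pderivR3 j (fun y => curlR3 (u t) y i) x| ≤ M := fun i j => by
    obtain ⟨G, hG, hGu⟩ := hu.exists_isPeriodicContDiff_vorticity_gradient hT i j
    obtain ⟨M, hM0, hM⟩ := hG.exists_abs_le hL
    exact ⟨M, hM0, fun t ht x => hGu t ht x ▸ hM t ht x⟩
  have h4 : ∀ i : Fin 3, ∃ M, 0 ≤ M ∧ ∀ s ∈ Icc 0 T, ∀ t ∈ Icc 0 T, ∀ x,
      |u t x i - u s x i| ≤ M * |t - s| := fun i =>
    IsPeriodicContDiff.exists_abs_sub_le hL hT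
      ⟨(hu.isPeriodicContDiff_velocity i).contDiffOn.of_le (by norm_num),
        (hu.isPeriodicContDiff_velocity i).periodic⟩
  have h5 : ∀ i j : Fin 3, ∃ M, 0 ≤ M ∧ ∀ s ∈ Icc 0 T, ∀ t ∈ Icc 0 T, ∀ x,
      |pderivR3 j (fun y => u t y i) x - pderivR3 j (fun y => u s y i) x| ≤ M * |t - s| :=
    fun i j => by
      obtain ⟨G, hG, hGu⟩ := hu.exists_isPeriodicContDiff_gradient hT i j
      obtain ⟨M, hM0, hM⟩ := IsPeriodicContDiff.exists_abs_sub_le hL hT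
        ⟨hG.contDiffOn.of_le (by norm_num), hG.periodic⟩
      exact ⟨M, hM0, fun s hs t ht x => hGu t ht x ▸ hGu s hs x ▸ hM s hs t ht x⟩
  choose A hA0 hA using h1
  choose B hB0 hB using h2
  choose C hC0 hC using h3
  choose D hD0 hD using h4
  choose E hE0 hE using h5
  obtain ⟨m₁, hm₁⟩ := (finite_range A).bddAbove
  obtain ⟨m₂, hm₂⟩ := (finite_range fun k : Fin 3 × Fin 3 => B k.1 k.2).bddAbove
  obtain ⟨m₃, hm₃⟩ := (finite_range fun k : Fin 3 × Fin 3 => C k.1 k.2).bddAbove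
  obtain ⟨m₄, hm₄⟩ := (finite_range D).bddAbove
  obtain ⟨m₅, hm₅⟩ := (finite_range fun k : Fin 3 × Fin 3 => E k.1 k.2).bddAbove
  set M := max m₁ (max m₂ (max m₃ (max m₄ m₅))) with hM
  have kA : ∀ i, A i ≤ M := fun i => (hm₁ (mem_range_self i)).trans (by simp [hM])
  have kB : ∀ i j, B i j ≤ M := fun i j => (hm₂ (mem_range_self (i, j))).trans (by simp [hM])
  have kC : ∀ i j, C i j ≤ M := fun i j => (hm₃ (mem_range_self (i, j))).trans (by simp [hM])
  have kD : ∀ i, D i ≤ M := fun i => (hm₄ (mem_range_self i)).trans (by simp [hM])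
  have kE : ∀ i j, E i j ≤ M := fun i j => (hm₅ (mem_range_self (i, j))).trans (by simp [hM])
  refine ⟨M, (hA0 0).trans (kA 0), fun t ht x i => ⟨(hA i t ht x).trans (kA i),
    fun j => (hB i j t ht x).trans (kB i j), fun j => (hC i j t ht x).trans (kC i j),
    fun s hs => ⟨(hD i s hs t ht x).trans ?_, fun j => (hE i j s hs t ht x).trans ?_⟩⟩⟩
  · exact mul_le_mul_of_nonneg_right (kD i) (abs_nonneg _)
  · exact mul_le_mul_of_nonneg_right (kE i j) (abs_nonneg _)

/-- The one-step error of the vorticity when the velocity is frozen at the right end `b`. -/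
theorem norm_vorticity_sub_le {M a b : ℝ} (hu : IsNSESolution σ L T f φ u p) (hL : 0 < L)
    (hT : 0 < T) (ha : 0 ≤ a) (hab : a < b) (hb : b ≤ T) (hM : 0 ≤ M)
    (hbound : ∀ t ∈ Icc 0 T, ∀ x, ∀ i : Fin 3, |curlR3 (u t) x i| ≤ M ∧
      (∀ j, |pderivR3 j (fun y => u t y i) x| ≤ M) ∧
      (∀ j, |pderivR3 j (fun y => curlR3 (u t) y i) x| ≤ M) ∧
      ∀ s ∈ Icc 0 T, |u t x i - u s x i| ≤ M * |t - s| ∧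
        ∀ j, |pderivR3 j (fun y => u t y i) x - pderivR3 j (fun y => u s y i) x| ≤ M * |t - s|)
    {w : ℝ → R3 → R3}
    (hw : IsFrozenVorticitySolution σ L a b (u b) (fun t => curlR3 (f t)) (curlR3 (u b)) w)
    {t : ℝ} (ht : t ∈ Icc a b) (x : R3) :
    ‖curlR3 (u t) x - w t x‖
      ≤ 3 * (6 * M ^ 2 * (b - a)) * (b - t) * Real.exp ((9 * M + 1) * (b - t)) := by
  have hsub : Icc a b ⊆ Icc 0 T := Icc_subset_Icc ha hb
  have hsub' : Ico a b ⊆ Ico 0 T := Ico_subset_Ico ha hb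
  have hbT : b ∈ Icc 0 T := ⟨ha.trans hab.le, hb⟩
  have hω : ∀ t ∈ Icc 0 T, ContDiff ℝ 2 (curlR3 (u t)) := fun t ht =>
    contDiff_curlR3 (n := 2) (by norm_num; exact hu.contDiff_velocity ht)
  have hwd : ∀ t ∈ Ico a b, ∀ x i,
      DifferentiableWithinAt ℝ (fun s => w s x i) (Icc a b) t := fun t ht x i =>
    differentiableWithinAt_euclidean.1 (hw.smooth_time t ht x) i
  -- The source bound is `B = 6M²(b - a)`: each of `(u - û,∇)ω` and `(ω,∇)(u - û)` is a sum of three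
  -- products of size at most `M · M(b - a)`.
  refine norm_le_of_parabolic_system (c := σ ^ 2 / 2) (L := L) (a := a) (v := u b)
    (δ := fun t x => curlR3 (u t) x - w t x) (by positivity) hL
    (mul_nonneg (by positivity) (by linarith)) hM
    (fun i j x => (hbound b hbT x i).2.1 j) ?_ ?_ ?_ ?_ ?_ ?_ ht x
  · exact ((hu.continuousOn_vorticity hT).mono (prod_mono_left hsub)).sub hw.continuous_w
  · intro t ht x i
    obtain ⟨d, hd, -⟩ := hu.vorticity_equation hT (hsub' ht) x i
    exact (hd.mono hsub).differentiableWithinAt.sub (hwd t ht x i)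
  · exact fun t ht => (hω t (hsub (Ico_subset_Icc_self ht))).sub (hw.smooth_space t ht)
  · intro t ht j x
    simp only [isPeriodicR3_curlR3 (hu.periodic_u t (hsub ht)) j x, hw.periodic_w t ht j x]
  · intro t ht x i
    have htab : t ∈ Icc a b := Ico_subset_Icc_self ht
    have htT : t ∈ Icc 0 T := hsub htab
    obtain ⟨d, hd, hdeq⟩ := hu.vorticity_equation hT (hsub' ht) x i
    have hder : derivWithin (fun s => (curlR3 (u s) x - w s x) i) (Icc a b) t
        = d - derivWithin (fun s => w s x i) (Icc a b) t :=
      ((hd.mono hsub).sub (hwd t ht x i).hasDerivWithinAt).derivWithin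
        (uniqueDiffOn_Icc hab t htab)
    have hdv : ∀ {v : R3 → R3}, ContDiff ℝ 2 v → DifferentiableAt ℝ (fun y => v y i) x :=
      fun hv => (contDiff_apply_R3 hv i).differentiable two_ne_zero x
    have hu2 : ∀ s ∈ Icc 0 T, ContDiff ℝ 2 (u s) := fun s hs =>
      (hu.contDiff_velocity hs).of_le (by norm_num)
    rw [hder, laplacian_sub_apply (hω t htT) (hw.smooth_space t ht),
      advectR3_sub_right _ _ (hdv (hω t htT)) (hdv (hw.smooth_space t ht)), advectR3_sub_left]
    have hweq := hw.equation t ht x i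
    have htb : |t - b| ≤ b - a := by
      rw [abs_sub_comm, abs_of_nonneg (by linarith [ht.2])]
      linarith [ht.1]
    have hMab : M * |t - b| ≤ M * (b - a) := mul_le_mul_of_nonneg_left htb hM
    have r1 : |advectR3 (fun y => u t y - u b y) (curlR3 (u t)) i x| ≤ 3 * ((M * (b - a)) * M) :=
      abs_advectR3_le (mul_nonneg hM (by linarith))
        (fun j => ((hbound t htT x j).2.2.2 b hbT).1.trans hMab) i (hbound t htT x i).2.2.1
    have r2 : |advectR3 (curlR3 (u t)) (fun y => u t y - u b y) i x| ≤ 3 * (M * (M * (b - a))) := by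
      refine abs_advectR3_le hM (fun j => (hbound t htT x j).1) i fun j => ?_
      have h := pderivR3_sub (hdv (hu2 t htT)) (hdv (hu2 b hbT)) j
      refine le_of_eq_of_le ?_ ((((hbound t htT x i).2.2.2 b hbT).2 j).trans hMab)
      rw [← h]
      rfl
    rw [advectR3_sub_left] at r1
    rw [advectR3_sub_right _ _ (hdv (hu2 t htT)) (hdv (hu2 b hbT))] at r2
    rw [abs_le] at r1 r2 ⊢
    constructor <;> nlinarith [r1.1, r1.2, r2.1, r2.2]
  · intro x
    simp [hw.terminal x]

end IsNSESolution

theorem mainTheorem7 (σ L T : ℝ) (hσ : 0 < σ) (hL : 0 < L) (hT : 0 < T)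
    (f : ℝ → R3 → R3) (φ : R3 → R3) (u : ℝ → R3 → R3) (p : ℝ → R3 → ℝ)
    (hu : IsNSESolution σ L T f φ u p) :
    ∃ K : ℝ, 0 < K ∧ ∀ (N : ℕ), 0 < N → ∀ h : ℝ, h = T / N → ∀ k : ℕ, k < N →
      ∀ w : ℝ → R3 → R3,
        IsFrozenVorticitySolution σ L (k * h) ((k + 1) * h) (u ((k + 1) * h))
          (fun t => curlR3 (f t)) (curlR3 (u ((k + 1) * h))) w →
        ∀ t ∈ Icc (k * h) ((k + 1) * h), ∀ x : R3,
          ‖curlR3 (u t) x - w t x‖ ≤ K * h ^ 2 := by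
  obtain ⟨M, hM, hbound⟩ := hu.exists_uniform_bounds hL hT
  -- Here `18 = 3 · 6` combines the factor of the maximum principle with that of the source, and the
  -- exponential is bounded over the whole of `[0, T]`. The `+ 1` keeps the constant positive when
  -- `M = 0`.
  refine ⟨18 * M ^ 2 * Real.exp ((9 * M + 1) * T) + 1, by positivity, ?_⟩
  intro N hN h hh k hk w hw t ht x
  have hN' : (0 : ℝ) < N := Nat.cast_pos.2 hN
  have hh0 : 0 < h := hh ▸ div_pos hT hN'
  have hNh : N * h = T := by rw [hh]; field_simp
  have hk' : (k : ℝ) + 1 ≤ N := by exact_mod_cast hk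
  have hkT : ((k : ℝ) + 1) * h ≤ T := hNh ▸ mul_le_mul_of_nonneg_right hk' hh0.le
  have hk0 : 0 ≤ (k : ℝ) * h := by positivity
  refine (hu.norm_vorticity_sub_le hL hT hk0 (by linarith) hkT hM hbound hw ht x).trans ?_
  have e1 : ((k : ℝ) + 1) * h - k * h = h := by ring
  have e2 : ((k : ℝ) + 1) * h - t ≤ h := by linarith [ht.1]
  have e3 : 0 ≤ ((k : ℝ) + 1) * h - t := by linarith [ht.2]
  have e4 : ((k : ℝ) + 1) * h - t ≤ T := by linarith [ht.1]
  rw [e1]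
  calc 3 * (6 * M ^ 2 * h) * ((k + 1) * h - t) * Real.exp ((9 * M + 1) * ((k + 1) * h - t))
      ≤ 3 * (6 * M ^ 2 * h) * h * Real.exp ((9 * M + 1) * T) := by gcongr
    _ = 18 * M ^ 2 * Real.exp ((9 * M + 1) * T) * h ^ 2 := by ring
    _ ≤ _ := mul_le_mul_of_nonneg_right (by linarith) (by positivity)
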